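/- Let $n\ge 1$ and $1\le p<\infty$. A weight is a non-negative, locally integrable function $w$ on $\mathbb R^n$; write $w(E)=\int_E w(x)\,dx$. For $1<p<\infty$, $w\in A_p$ means $$\sup_B \Big(\frac1{|B|}\int_B w\,dx\Big)\Big(\frac1{|B|}\int_B w^{1/(1-p)}\,dx\Big)^{p-1}<\infty ,$$ and $w\in A_1$ means $$\sup_B \Big(\operatorname*{ess\,sup}_{x\in B} w(x)^{-1}\Big)\frac1{|B|}\int_B w\,dx<\infty ,$$ where the suprema are over all balls $B\subset\mathbb R^n$ (taking cubes instead gives the same classes). Let $r_w=\inf\{q>1: w\in A_q\}$. For a (Lebesgue) measurable $f:\mathbb R^n\to\mathbb R$ put $\operatorname{osc}_E(f)=\sup_{x,y\in E}|f(x)-f(y)|$. We say $f\in RBV^p(\mathbb R^n,w)$ if $$V_p(f;\mathbb R^n,w)=\sup_{\mathcal D}\Big[\sum_{B_k\in\mathcal D}\Big(\frac{\operatorname{osc}_{B_k}(f)}{r_k}\Big)^p w(B_k)\Big]^{1/p}<\infty ,$$ where the supremum is over all countable collections $\mathcal D=\{B_k\}$ of pairwise disjoint open balls in $\mathbb R^n$,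 $r_k>0$ being the radius of $B_k$. Let $W^{1,p}(\mathbb R^n,w)$ be the set of $f\in L^p(\mathbb R^n,w)$ whose first-order weak partial derivatives $D_1f,\dots,D_nf$ exist and belong to $L^p(\mathbb R^n,w)$, where $L^p(\mathbb R^n,w)$ is the $L^p$ space of the measure $w\,dx$ (weak derivatives are understood in the usual sense, for locally integrable functions). **Corollary.** Let $1\le p<\infty$ and let $w\in A_p$ be a weight that is not almost everywhere equal to $0$. 1. Every $f\in RBV^p(\mathbb R^n,w)$ is differentiable at Lebesgue-almost every point of $\mathbb R^n$. 2. If moreover $p>n\,r_w$, then every $f\in W^{1,p}(\mathbb R^n,w)$ is, after redefinition on a Lebesgue-null set, continuous on $\mathbb R^n$ and differentiable at Lebesgue-almost every point of $\mathbb R^n$. -/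

import Mathlib

open MeasureTheory Filter Topology
open scoped ENNReal ContDiff

noncomputable section

namespace WeightedRBV

/-- The measure `w(E) = ∫_E w(x) dx` induced by a weight `w`. -/
def weightMeasure {n : ℕ} (w : EuclideanSpace ℝ (Fin n) → ℝ) :
    Measure (EuclideanSpace ℝ (Fin n)) :=
  volume.withDensity (fun x => ENNReal.ofReal (w x))

/-- A weight: a non-negative, locally integrable function. -/
structure IsWeight {n : ℕ} (w : EuclideanSpace ℝ (Fin n) → ℝ) : Prop where
  nonneg : ∀ x, 0 ≤ w x
  locallyIntegrable : LocallyIntegrable w volume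

/-- The Muckenhoupt characteristic `[w]_{A_p}`, the supremum being over all balls. All quantities
live in `[0, ∞]`; in particular `0 ^ (1 / (1 - p)) = ∞` for `p > 1`, and `0⁻¹ = ∞`. -/
def muckenhouptConst {n : ℕ} (p : ℝ) (w : EuclideanSpace ℝ (Fin n) → ℝ) : ℝ≥0∞ :=
  if p = 1 then
    ⨆ (c : EuclideanSpace ℝ (Fin n)) (r : ℝ) (_ : 0 < r),
      essSup (fun x => (ENNReal.ofReal (w x))⁻¹) (volume.restrict (Metric.ball c r)) *
        ⨍⁻ x in Metric.ball c r, ENNReal.ofReal (w x) ∂volume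
  else
    ⨆ (c : EuclideanSpace ℝ (Fin n)) (r : ℝ) (_ : 0 < r),
      (⨍⁻ x in Metric.ball c r, ENNReal.ofReal (w x) ∂volume) *
        (⨍⁻ x in Metric.ball c r, ENNReal.ofReal (w x) ^ (1 / (1 - p)) ∂volume) ^ (p - 1)

/-- `w ∈ A_p` (for `1 ≤ p < ∞`). -/
structure IsMuckenhoupt {n : ℕ} (p : ℝ) (w : EuclideanSpace ℝ (Fin n) → ℝ) : Prop where
  isWeight : IsWeight w
  const_lt_top : muckenhouptConst p w < ⊤

/-- `r_w = inf {q > 1 : w ∈ A_q}`. -/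
def criticalIndex {n : ℕ} (w : EuclideanSpace ℝ (Fin n) → ℝ) : ℝ :=
  sInf {q : ℝ | 1 < q ∧ IsMuckenhoupt q w}

/-- The oscillation `sup_{x, y ∈ s} |f x - f y|`, with values in `[0, ∞]`. -/
def osc {n : ℕ} (f : EuclideanSpace ℝ (Fin n) → ℝ) (s : Set (EuclideanSpace ℝ (Fin n))) : ℝ≥0∞ :=
  ⨆ x ∈ s, ⨆ y ∈ s, ENNReal.ofReal |f x - f y|

/-- A countable collection of pairwise disjoint open balls of positive radius; a ball is recorded
as the pair (centre, radius). -/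
structure IsDisjointBalls {n : ℕ} (D : Set (EuclideanSpace ℝ (Fin n) × ℝ)) : Prop where
  countable : D.Countable
  radius_pos : ∀ b ∈ D, 0 < b.2
  disjoint : D.PairwiseDisjoint (fun b => Metric.ball b.1 b.2)

/-- The weighted Riesz `p`-variation `V_p(f; ℝⁿ, w)`, with values in `[0, ∞]`. -/
def rieszVariation {n : ℕ} (p : ℝ) (w f : EuclideanSpace ℝ (Fin n) → ℝ) : ℝ≥0∞ :=
  ⨆ (D : Set (EuclideanSpace ℝ (Fin n) × ℝ)) (_ : IsDisjointBalls D),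
    (∑' b : D, (osc f (Metric.ball b.1.1 b.1.2) / ENNReal.ofReal b.1.2) ^ p *
      weightMeasure w (Metric.ball b.1.1 b.1.2)) ^ (1 / p)

/-- `f ∈ RBV^p(ℝⁿ, w)`: `f` is (Lebesgue) measurable and has finite weighted Riesz
`p`-variation. -/
structure MemRBV {n : ℕ} (p : ℝ) (w f : EuclideanSpace ℝ (Fin n) → ℝ) : Prop where
  aemeasurable : AEMeasurable f volume
  variation_lt_top : rieszVariation p w f < ⊤

/-- `g` is the weak `j`-th partial derivative of `f` on `ℝⁿ`. -/
structure IsWeakPartialDeriv {n : ℕ} (j : Fin n) (f g : EuclideanSpace ℝ (Fin n) → ℝ) :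
    Prop where
  locallyIntegrable : LocallyIntegrable f volume
  locallyIntegrable_deriv : LocallyIntegrable g volume
  integral_eq : ∀ φ : EuclideanSpace ℝ (Fin n) → ℝ, ContDiff ℝ ∞ φ → HasCompactSupport φ →
    ∫ x, f x * fderiv ℝ φ x (EuclideanSpace.single j 1) = - ∫ x, g x * φ x

/-- `f ∈ W^{1,p}(ℝⁿ, w)`: `f` and all its first order weak partial derivatives belong to
`L^p(ℝⁿ, w)`. -/
structure MemSobolev {n : ℕ} (p : ℝ) (w f : EuclideanSpace ℝ (Fin n) → ℝ) : Prop where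
  memLp : MemLp f (ENNReal.ofReal p) (weightMeasure w)
  exists_deriv : ∀ j : Fin n, ∃ g : EuclideanSpace ℝ (Fin n) → ℝ,
    IsWeakPartialDeriv j f g ∧ MemLp g (ENNReal.ofReal p) (weightMeasure w)

end WeightedRBV

end

/-! Both parts rest on Stepanov's theorem (`ae_differentiableAt_of_isBigO`): it suffices to show
that the function is pointwise Lipschitz at almost every point.

For finite Riesz variation, let `E` be the set where this fails. Each point of `E` is the centre of
arbitrarily small balls with `osc f ≥ N r`. Besicovitch's covering theorem extracts disjoint balls
covering `w`-almost all of `E`, so `N ^ p * w(E) ≤ V_p ^ p` for every `N`, and `w(E) = 0`. A nonzero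
Muckenhoupt weight is positive a.e. (`IsMuckenhoupt.ae_ne_zero`), so `E` is Lebesgue null.

For Sobolev functions, `n r_w < p` provides `q > 1` with `w ∈ A_q` and `s = p / q > n`. Hölder's
inequality against the dual weight `w ^ (1 / (1 - q))` puts the weak derivatives in unweighted
`L^s_loc`. Morrey's growth theorem, proved for mollifications and passed to the limit, gives a
continuous representative whose oscillation on `B(x, r)` is at most a constant times `r ^ (1 - n/s)
* μ(B(x, 2r)) ^ (1/s)`, where `μ = ∑ |g_j|^s dx`. By Lebesgue differentiation `μ(B(x, r)) = O(r ^
n)` at almost every `x`, so the bound becomes linear in `r` and Stepanov's theorem applies again. -/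

/-! ### Stepanov's theorem, from Rademacher's theorem. -/

section Stepanov

/-- A function squeezed between two functions which are differentiable at `x` and agree with it
there is differentiable at `x`. -/
theorem DifferentiableAt.of_squeeze {E : Type*} [NormedAddCommGroup E] [NormedSpace ℝ E]
    {u v f : E → ℝ} {x : E} (hu : DifferentiableAt ℝ u x) (hv : DifferentiableAt ℝ v x)
    (hvf : ∀ᶠ y in 𝓝 x, v y ≤ f y) (hfu : ∀ᶠ y in 𝓝 x, f y ≤ u y) (hux : u x = f x)
    (hvx : v x = f x) : DifferentiableAt ℝ f x := by
  -- `u - v` is nonnegative near `x` and vanishes at `x`, so the two derivatives coincide there.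
  have hmin : IsLocalMin (fun y => u y - v y) x := by
    filter_upwards [hvf, hfu] with y h1 h2
    rw [hux, hvx, sub_self]
    linarith
  have hd : fderiv ℝ u x = fderiv ℝ v x := by
    have := hmin.fderiv_eq_zero
    rw [fderiv_fun_sub hu hv] at this
    exact sub_eq_zero.mp this
  have h1 := hu.hasFDerivAt.isLittleO
  have h2 := hv.hasFDerivAt.isLittleO
  rw [← hd] at h2
  refine ⟨fderiv ℝ u x, HasFDerivAt.of_isLittleO ?_⟩
  rw [Asymptotics.isLittleO_iff] at h1 h2 ⊢
  intro c hc
  filter_upwards [h1 hc, h2 hc, hvf, hfu] with y a b c d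
  rw [Real.norm_eq_abs, abs_le] at a b ⊢
  rw [hux] at a
  rw [hvx] at b
  constructor <;> linarith [a.1, a.2, b.1, b.2]

/-- The least `N`-Lipschitz majorant on a nonempty set of a function bounded above there. -/
theorem exists_lipschitz_majorant {E : Type*} [NormedAddCommGroup E] (f : E → ℝ) (U : Set E)
    (N : NNReal) (hU : U.Nonempty) (hf : BddAbove (f '' U)) :
    ∃ u : E → ℝ, LipschitzWith N u ∧ (∀ x ∈ U, f x ≤ u x) ∧
      ∀ x, ∀ c : ℝ, (∀ z ∈ U, f z ≤ c + N * ‖z - x‖) → u x ≤ c := by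
  have : Nonempty U := hU.to_subtype
  obtain ⟨b, hb⟩ := hf
  have hbdd : ∀ x, BddAbove (Set.range fun z : U => f z - N * ‖(z : E) - x‖) := by
    intro x
    refine ⟨b, ?_⟩
    rintro _ ⟨z, rfl⟩
    have h1 : f z ≤ b := hb ⟨z, z.2, rfl⟩
    have h2 : 0 ≤ (N : ℝ) * ‖(z : E) - x‖ := by positivity
    simp only
    linarith
  -- McShane's formula; the upper bound of `f` on `U` keeps the supremum finite.
  refine ⟨fun x => ⨆ z : U, f z - N * ‖(z : E) - x‖, ?_, ?_, ?_⟩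
  · refine LipschitzWith.of_le_add_mul N fun x y => ?_
    refine ciSup_le fun z => ?_
    have h1 := le_ciSup (hbdd y) z
    have h2 : ‖(z : E) - y‖ ≤ ‖(z : E) - x‖ + dist x y := by
      rw [dist_eq_norm]
      simpa using norm_add_le ((z : E) - x) (x - y)
    have h3 := mul_le_mul_of_nonneg_left h2 N.2
    have h4 : (N : ℝ) * ‖(z : E) - y‖ ≤ N * ‖(z : E) - x‖ + N * dist x y := by
      rw [← mul_add]; exact h3
    linarith
  · intro x hx
    simpa using le_ciSup (hbdd x) ⟨x, hx⟩
  · intro x c hc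
    exact ciSup_le fun z => by linarith [hc z z.2]

/-- **Stepanov's theorem**: a function is differentiable at almost every point where it is pointwise
Lipschitz. -/
theorem ae_differentiableAt_of_isBigO {E : Type*} [NormedAddCommGroup E] [NormedSpace ℝ E]
    [FiniteDimensional ℝ E] [MeasurableSpace E] [BorelSpace E] (μ : Measure E)
    [μ.IsAddHaarMeasure] (f : E → ℝ) :
    ∀ᵐ x ∂μ, ((fun y => f y - f x) =O[𝓝 x] fun y => y - x) → DifferentiableAt ℝ f x := by
  set B := TopologicalSpace.countableBasis E
  have hB := TopologicalSpace.isBasis_countableBasis E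
  have hBc : B.Countable := TopologicalSpace.countable_countableBasis E
  have key : ∀ U ∈ B, ∀ N : ℕ, ∀ᵐ x ∂μ, x ∈ U → (∀ z ∈ U, |f z - f x| ≤ N * ‖z - x‖) →
      Bornology.IsBounded U → DifferentiableAt ℝ f x := by
    intro U hU N
    -- The envelopes `u` and `-v` depend only on `U` and `N`, so Rademacher's null sets are
    -- countably many. At a point `x` with the `N`-bound on `U`, both envelopes touch `f`. If the
    -- envelopes are unavailable, no such `x` exists, since the bound makes `f` bounded on the
    -- bounded set `U`.
    by_cases hbd : U.Nonempty ∧ BddAbove (f '' U) ∧ BddAbove ((fun x => - f x) '' U)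
    · obtain ⟨u, hu, hu1, hu2⟩ := exists_lipschitz_majorant f U N hbd.1 hbd.2.1
      obtain ⟨v, hv, hv1, hv2⟩ := exists_lipschitz_majorant (fun x => - f x) U N hbd.1 hbd.2.2
      filter_upwards [hu.ae_differentiableAt (μ := μ), hv.ae_differentiableAt (μ := μ)]
        with x hux hvx hxU hx _
      have hnhds : U ∈ 𝓝 x := (hB.isOpen hU).mem_nhds hxU
      refine hux.of_squeeze (v := fun y => - v y) hvx.fun_neg ?_ ?_ ?_ ?_
      · filter_upwards [hnhds] with y hy
        linarith [hv1 y hy]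
      · filter_upwards [hnhds] with y hy using hu1 y hy
      · refine le_antisymm (hu2 x _ fun z hz => ?_) (hu1 x hxU)
        have := (abs_le.mp (hx z hz)).2
        simp only [NNReal.coe_natCast]
        linarith
      · have h1 := hv1 x hxU
        have h2 := hv2 x (- f x) fun z hz => by
          have := (abs_le.mp (hx z hz)).1
          simp only [NNReal.coe_natCast]
          linarith
        linarith
    · refine Eventually.of_forall fun x hxU hx hbU => absurd ?_ hbd
      obtain ⟨R, hR⟩ := hbU.subset_closedBall x
      have hR' : ∀ z ∈ U, (N : ℝ) * ‖z - x‖ ≤ N * R := fun z hz => by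
        have := hR hz
        rw [Metric.mem_closedBall, dist_eq_norm] at this
        gcongr
      refine ⟨⟨x, hxU⟩, ⟨f x + N * R, ?_⟩, ⟨- f x + N * R, ?_⟩⟩
      · rintro _ ⟨z, hz, rfl⟩
        linarith [(abs_le.mp (hx z hz)).2, hR' z hz]
      · rintro _ ⟨z, hz, rfl⟩
        simp only
        linarith [(abs_le.mp (hx z hz)).1, hR' z hz]
  have key' : ∀ᵐ x ∂μ, ∀ U ∈ B, ∀ N : ℕ, x ∈ U → (∀ z ∈ U, |f z - f x| ≤ N * ‖z - x‖) →
      Bornology.IsBounded U → DifferentiableAt ℝ f x := by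
    rw [ae_ball_iff hBc]
    intro U hU
    rw [ae_all_iff]
    exact key U hU
  filter_upwards [key'] with x hx hO
  obtain ⟨C, hC⟩ := hO.bound
  obtain ⟨N, hN⟩ := exists_nat_ge C
  obtain ⟨U, hU, hxU, hsub⟩ := hB.mem_nhds_iff.mp
    (Filter.inter_mem hC (Metric.ball_mem_nhds x one_pos))
  refine hx U hU N hxU (fun z hz => ?_) (Metric.isBounded_ball.subset fun z hz => (hsub hz).2)
  have h1 : ‖f z - f x‖ ≤ C * ‖z - x‖ := (hsub hz).1
  exact h1.trans (by gcongr)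

end Stepanov

/-! ### Finite Riesz variation forces pointwise Lipschitz behaviour. -/

namespace WeightedRBV

instance {n : ℕ} (w : EuclideanSpace ℝ (Fin n) → ℝ) : SFinite (weightMeasure w) := by
  unfold weightMeasure; infer_instance

theorem weightMeasure_absolutelyContinuous {n : ℕ} (w : EuclideanSpace ℝ (Fin n) → ℝ) :
    weightMeasure w ≪ volume := withDensity_absolutelyContinuous _ _

/-- Besicovitch covering yields closed balls while the variation uses open ones; spheres are null,
so nothing is lost. -/
theorem weightMeasure_closedBall {n : ℕ} (w : EuclideanSpace ℝ (Fin n) → ℝ)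
    (c : EuclideanSpace ℝ (Fin n)) {r : ℝ} (hr : 0 < r) :
    weightMeasure w (Metric.closedBall c r) = weightMeasure w (Metric.ball c r) := by
  refine le_antisymm ?_ (measure_mono Metric.ball_subset_closedBall)
  rw [← Metric.ball_union_sphere]
  refine (measure_union_le _ _).trans ?_
  rw [weightMeasure_absolutelyContinuous w (Measure.addHaar_sphere_of_ne_zero volume c hr.ne'),
    add_zero]

/-- A set each of whose points is the centre of arbitrarily small balls with `osc f ≥ M r` has
small weighted measure. -/
theorem mul_weightMeasure_le_rieszVariation {n : ℕ} {p : ℝ} (hp : 1 ≤ p)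
    (w f : EuclideanSpace ℝ (Fin n) → ℝ) (M : ℝ≥0∞) (E : Set (EuclideanSpace ℝ (Fin n)))
    (hE : ∀ x ∈ E, ∀ δ > 0, ∃ r ∈ Set.Ioo 0 δ,
      M ≤ osc f (Metric.ball x r) / ENNReal.ofReal r) :
    M ^ p * weightMeasure w E ≤ rieszVariation p w f ^ p := by
  obtain ⟨t, r, htc, -, htr, hcov, hdisj⟩ := Besicovitch.exists_disjoint_closedBall_covering_ae
    (weightMeasure w) (fun x => {r | M ≤ osc f (Metric.ball x r) / ENNReal.ofReal r}) E
    (fun x hx δ hδ => by obtain ⟨r, hr, h⟩ := hE x hx δ hδ; exact ⟨r, h, hr⟩)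
    (fun _ => 1) (fun _ _ => one_pos)
  set D : Set (EuclideanSpace ℝ (Fin n) × ℝ) := (fun x => (x, r x)) '' t
  have hD : IsDisjointBalls D := by
    refine ⟨htc.image _, ?_, ?_⟩
    · rintro _ ⟨x, hx, rfl⟩
      exact (htr x hx).2.1
    · rintro _ ⟨x, hx, rfl⟩ _ ⟨y, hy, rfl⟩ hxy
      exact (hdisj hx hy fun h => hxy (by rw [h])).mono Metric.ball_subset_closedBall
        Metric.ball_subset_closedBall
  have h1 : (∑' b : D, (osc f (Metric.ball b.1.1 b.1.2) / ENNReal.ofReal b.1.2) ^ p *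
      weightMeasure w (Metric.ball b.1.1 b.1.2)) ≤ rieszVariation p w f ^ p := by
    have h2 : _ ≤ rieszVariation p w f := le_iSup₂ (f := fun (D : Set (EuclideanSpace ℝ (Fin n) × ℝ))
      (_ : IsDisjointBalls D) => (∑' b : D, (osc f (Metric.ball b.1.1 b.1.2) /
        ENNReal.ofReal b.1.2) ^ p * weightMeasure w (Metric.ball b.1.1 b.1.2)) ^ (1 / p)) D hD
    have h3 := ENNReal.rpow_le_rpow h2 (zero_le_one.trans hp)
    rwa [← ENNReal.rpow_mul, one_div, inv_mul_cancel₀ (by positivity), ENNReal.rpow_one] at h3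
  refine le_trans ?_ h1
  have : Countable D := (htc.image _).to_subtype
  have h4 : weightMeasure w E ≤ ∑' b : D, weightMeasure w (Metric.ball b.1.1 b.1.2) := by
    calc weightMeasure w E ≤ weightMeasure w (E \ ⋃ x ∈ t, Metric.closedBall x (r x)) +
          weightMeasure w (⋃ x ∈ t, Metric.closedBall x (r x)) := by
            refine (measure_mono ?_).trans (measure_union_le _ _)
            rw [Set.sdiff_union_self]
            exact Set.subset_union_left
      _ = weightMeasure w (⋃ b ∈ D, Metric.closedBall b.1 b.2) := by
            rw [hcov, zero_add, Set.biUnion_image]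
      _ ≤ ∑' b : D, weightMeasure w (Metric.closedBall b.1.1 b.1.2) :=
            measure_biUnion_le _ (htc.image _) _
      _ = _ := tsum_congr fun b => weightMeasure_closedBall w _ (hD.radius_pos _ b.2)
  calc M ^ p * weightMeasure w E
      ≤ M ^ p * ∑' b : D, weightMeasure w (Metric.ball b.1.1 b.1.2) := by gcongr
    _ = ∑' b : D, M ^ p * weightMeasure w (Metric.ball b.1.1 b.1.2) := ENNReal.tsum_mul_left.symm
    _ ≤ _ := by
      refine ENNReal.tsum_le_tsum fun b => ?_
      gcongr
      obtain ⟨_, x, hx, rfl⟩ := b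
      exact (htr x hx).1

theorem ofReal_abs_sub_le_osc {n : ℕ} (f : EuclideanSpace ℝ (Fin n) → ℝ)
    {s : Set (EuclideanSpace ℝ (Fin n))} {x y : EuclideanSpace ℝ (Fin n)} (hx : x ∈ s)
    (hy : y ∈ s) : ENNReal.ofReal |f x - f y| ≤ osc f s :=
  le_trans (le_iSup₂ (f := fun y (_ : y ∈ s) => ENNReal.ofReal |f x - f y|) y hy)
    (le_iSup₂ (f := fun x (_ : x ∈ s) => ⨆ y ∈ s, ENNReal.ofReal |f x - f y|) x hx)

/-- A function of finite Riesz variation is pointwise Lipschitz almost everywhere with respect to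
the weight. -/
theorem MemRBV.ae_isBigO {n : ℕ} {p : ℝ} (hp : 1 ≤ p) {w f : EuclideanSpace ℝ (Fin n) → ℝ}
    (hf : MemRBV p w f) :
    ∀ᵐ x ∂(weightMeasure w), (fun y => f y - f x) =O[𝓝 x] fun y => y - x := by
  have hp0 : 0 < p := zero_lt_one.trans_le hp
  rw [ae_iff]
  set E := {x | ¬ (fun y => f y - f x) =O[𝓝 x] fun y => y - x}
  have key : ∀ N : ℕ, (N : ℝ≥0∞) ^ p * weightMeasure w E ≤ rieszVariation p w f ^ p := by
    intro N
    refine mul_weightMeasure_le_rieszVariation hp w f N E fun x hx δ hδ => ?_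
    -- The open ball of radius `2 * ‖y - x‖` contains `y`; the slope `2 * N` compensates for this
    -- doubling, as `δ / 2` does below.
    have h1 : ∃ᶠ y in 𝓝 x, (2 * N : ℝ) * ‖y - x‖ < ‖f y - f x‖ := by
      intro h
      exact hx (Asymptotics.IsBigO.of_bound (2 * N) (h.mono fun y hy => not_lt.mp hy))
    obtain ⟨y, hy, hyδ⟩ := (h1.and_eventually
      (Metric.ball_mem_nhds x (half_pos hδ))).exists
    have hne : 0 < ‖y - x‖ := by
      rw [norm_pos_iff, sub_ne_zero]
      rintro rfl
      simp at hy
    rw [dist_eq_norm] at hyδ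
    refine ⟨2 * ‖y - x‖, ⟨by positivity, by linarith⟩, ?_⟩
    rw [ENNReal.le_div_iff_mul_le (Or.inl (by simpa using hne.ne')) (Or.inl ENNReal.ofReal_ne_top)]
    refine le_trans ?_ (ofReal_abs_sub_le_osc f (x := y) (y := x) ?_ ?_)
    · rw [← ENNReal.ofReal_natCast, ← ENNReal.ofReal_mul (by positivity)]
      refine ENNReal.ofReal_le_ofReal ?_
      rw [Real.norm_eq_abs (f y - f x)] at hy
      linarith
    · rw [Metric.mem_ball, dist_eq_norm]; linarith
    · exact Metric.mem_ball_self (by positivity)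
  by_contra hE
  have hV : rieszVariation p w f ^ p ≠ ⊤ := ENNReal.rpow_ne_top_of_nonneg hp0.le
    hf.variation_lt_top.ne
  have hN : ∀ N : ℕ, (N : ℝ≥0∞) ≤ (rieszVariation p w f ^ p / weightMeasure w E) ^ (1 / p) := by
    intro N
    rw [one_div, ENNReal.le_rpow_inv_iff hp0]
    exact ENNReal.le_div_iff_mul_le (Or.inl hE) (Or.inr hV) |>.mpr (key N)
  have hfin : (rieszVariation p w f ^ p / weightMeasure w E) ^ (1 / p) ≠ ⊤ :=
    ENNReal.rpow_ne_top_of_nonneg (by positivity) (ENNReal.div_ne_top hV hE)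
  obtain ⟨N, hN'⟩ := ENNReal.exists_nat_gt hfin
  exact absurd (hN N) (not_le.mpr hN')

end WeightedRBV

/-! ### Positivity and duality for Muckenhoupt weights. -/

namespace WeightedRBV

variable {n : ℕ} {w : EuclideanSpace ℝ (Fin n) → ℝ}

theorem IsWeight.aemeasurable (hw : IsWeight w) : AEMeasurable w volume :=
  hw.locallyIntegrable.aestronglyMeasurable.aemeasurable

/-- Having all large radii, not just one, lets a single ball serve two sets at once. -/
theorem exists_pos_ball_of_measure_ne_zero {s : Set (EuclideanSpace ℝ (Fin n))}
    (hs : volume s ≠ 0) : ∃ k : ℕ, ∀ m, k ≤ m → volume (s ∩ Metric.ball 0 (m : ℝ)) ≠ 0 := by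
  by_contra! h
  refine hs ?_
  have : s ⊆ ⋃ k : ℕ, s ∩ Metric.ball 0 (k : ℝ) := fun x hx => by
    obtain ⟨k, hk⟩ := exists_nat_gt ‖x‖
    exact Set.mem_iUnion.mpr ⟨k, hx, by simpa using hk⟩
  refine measure_mono_null this (measure_iUnion_null fun k => ?_)
  obtain ⟨m, hkm, hm⟩ := h k
  exact measure_mono_null (Set.inter_subset_inter_right _
    (Metric.ball_subset_ball (by exact_mod_cast hkm))) hm

theorem laverage_ofReal_ne_zero (hw : IsWeight w) {s : Set (EuclideanSpace ℝ (Fin n))}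
    (hs : volume s ≠ ⊤) (h : volume ({x | w x ≠ 0} ∩ s) ≠ 0) :
    ⨍⁻ x in s, ENNReal.ofReal (w x) ∂volume ≠ 0 := by
  rw [setLAverage_eq]
  refine (ENNReal.div_pos ?_ hs).ne'
  intro h0
  rw [lintegral_eq_zero_iff' hw.aemeasurable.ennreal_ofReal.restrict] at h0
  refine h (le_antisymm ((Measure.le_restrict_apply _ _).trans ?_) zero_le)
  refine (measure_mono_null (fun x (hx : w x ≠ 0) => ?_) (ae_iff.mp h0)).le
  simpa using lt_of_le_of_ne (hw.nonneg x) hx.symm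

theorem IsMuckenhoupt.mul_lt_top_of_ne_one {q : ℝ} (hq : q ≠ 1) (hw : IsMuckenhoupt q w)
    (c : EuclideanSpace ℝ (Fin n)) {r : ℝ} (hr : 0 < r) :
    (⨍⁻ x in Metric.ball c r, ENNReal.ofReal (w x) ∂volume) *
        (⨍⁻ x in Metric.ball c r, ENNReal.ofReal (w x) ^ (1 / (1 - q)) ∂volume) ^ (q - 1) < ⊤ := by
  have h := hw.const_lt_top
  rw [muckenhouptConst, if_neg hq] at h
  exact (le_iSup_of_le c (le_iSup₂ (f := fun r (_ : (0 : ℝ) < r) =>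
    (⨍⁻ x in Metric.ball c r, ENNReal.ofReal (w x) ∂volume) *
      (⨍⁻ x in Metric.ball c r, ENNReal.ofReal (w x) ^ (1 / (1 - q)) ∂volume) ^ (q - 1))
      r hr)).trans_lt h

theorem essSup_mul_laverage_le_muckenhouptConst (w : EuclideanSpace ℝ (Fin n) → ℝ)
    (c : EuclideanSpace ℝ (Fin n)) {r : ℝ} (hr : 0 < r) :
    essSup (fun x => (ENNReal.ofReal (w x))⁻¹) (volume.restrict (Metric.ball c r)) *
        ⨍⁻ x in Metric.ball c r, ENNReal.ofReal (w x) ∂volume ≤ muckenhouptConst 1 w := by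
  rw [muckenhouptConst, if_pos rfl]
  exact le_iSup_of_le c (le_iSup₂ (f := fun r (_ : (0 : ℝ) < r) =>
    essSup (fun x => (ENNReal.ofReal (w x))⁻¹) (volume.restrict (Metric.ball c r)) *
        ⨍⁻ x in Metric.ball c r, ENNReal.ofReal (w x) ∂volume) r hr)

/-- An `A_1` weight is an `A_2` weight. -/
theorem IsMuckenhoupt.two_of_one (hw : IsMuckenhoupt 1 w) : IsMuckenhoupt 2 w := by
  refine ⟨hw.isWeight, lt_of_le_of_lt ?_ hw.const_lt_top⟩
  rw [muckenhouptConst, if_neg (by norm_num)]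
  refine iSup_le fun c => iSup₂_le fun r hr => ?_
  refine le_trans ?_ (essSup_mul_laverage_le_muckenhouptConst w c hr)
  rw [mul_comm]
  gcongr
  -- For exponent `2` the dual factor is the average of `w⁻¹`, which is at most its essential
  -- supremum.
  norm_num [ENNReal.rpow_neg_one]
  refine (laverage_mono_ae (ENNReal.ae_le_essSup _)).trans ?_
  have : IsFiniteMeasure (volume.restrict (Metric.ball c r)) :=
    ⟨by simpa using measure_ball_lt_top⟩
  have : NeZero (volume.restrict (Metric.ball c r)) :=
    ⟨by simpa using (Metric.measure_ball_pos volume c hr).ne'⟩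
  rw [laverage_const]

/-- A Muckenhoupt weight which is not almost everywhere zero is almost everywhere positive. -/
theorem IsMuckenhoupt.ae_ne_zero {q : ℝ} (hq : 1 ≤ q) (hw : IsMuckenhoupt q w)
    (hw0 : ¬ w =ᵐ[volume] 0) : ∀ᵐ x ∂volume, w x ≠ 0 := by
  wlog hq1 : 1 < q generalizing q
  · obtain rfl : q = 1 := le_antisymm (not_lt.mp hq1) hq
    exact this one_le_two hw.two_of_one one_lt_two
  -- If `{w = 0}` and `{w ≠ 0}` both had positive measure, a large ball would meet both
  -- substantially: the average of `w` is positive while the dual average is infinite, as `0` to a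
  -- negative power is `∞`.
  by_contra h
  obtain ⟨k, hk⟩ := exists_pos_ball_of_measure_ne_zero (s := {x | w x ≠ 0}) hw0
  obtain ⟨l, hl⟩ := exists_pos_ball_of_measure_ne_zero (s := {x | ¬ w x ≠ 0}) h
  set m := max 1 (max k l)
  have hm : (0 : ℝ) < m := by simp [m]
  have h1 := laverage_ofReal_ne_zero hw.isWeight measure_ball_lt_top.ne (hk m (by simp [m]))
  have h2 := hl m (by simp [m])
  refine (hw.mul_lt_top_of_ne_one hq1.ne' 0 hm).ne ?_
  have h3 : ∫⁻ x in Metric.ball 0 (m : ℝ), ENNReal.ofReal (w x) ^ (1 / (1 - q)) = ⊤ := by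
    by_contra h3
    have h4 := ae_lt_top' (μ := volume.restrict (Metric.ball 0 (m : ℝ)))
      (hw.isWeight.aemeasurable.ennreal_ofReal.pow_const _).restrict h3
    refine h2 (le_antisymm ((Measure.le_restrict_apply _ _).trans ?_) zero_le)
    refine (measure_mono_null (fun x hx => ?_) (ae_iff.mp h4)).le
    simp only [ne_eq, not_not, Set.mem_ofPred_eq] at hx ⊢
    rw [hx, ENNReal.ofReal_zero, ENNReal.zero_rpow_of_neg]
    · simp
    · exact div_neg_of_pos_of_neg one_pos (by linarith)
  rw [setLAverage_eq (s := Metric.ball 0 (m : ℝ)) (f := fun x => ENNReal.ofReal (w x) ^ _), h3,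
    ENNReal.top_div_of_ne_top measure_ball_lt_top.ne, ENNReal.top_rpow_of_pos (by linarith),
    ENNReal.mul_top h1]

/-- The dual weight of a Muckenhoupt weight has finite integral over balls. -/
theorem IsMuckenhoupt.lintegral_dual_ne_top {q : ℝ} (hq : 1 < q) (hw : IsMuckenhoupt q w)
    (hw0 : ¬ w =ᵐ[volume] 0) (c : EuclideanSpace ℝ (Fin n)) (r : ℝ) :
    ∫⁻ x in Metric.ball c r, ENNReal.ofReal (w x) ^ (1 / (1 - q)) ≠ ⊤ := by
  rcases le_or_gt r 0 with hr | hr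
  · simp [Metric.ball_eq_empty.mpr hr]
  intro h3
  refine (hw.mul_lt_top_of_ne_one hq.ne' c hr).ne ?_
  rw [setLAverage_eq (s := Metric.ball c r) (f := fun x => ENNReal.ofReal (w x) ^ _), h3,
    ENNReal.top_div_of_ne_top measure_ball_lt_top.ne, ENNReal.top_rpow_of_pos (by linarith),
    ENNReal.mul_top]
  refine laverage_ofReal_ne_zero hw.isWeight measure_ball_lt_top.ne ?_
  have h1 : volume ({x | w x ≠ 0} ∩ Metric.ball c r) = volume (Metric.ball c r) :=
    Measure.measure_inter_eq_of_ae (hw.ae_ne_zero hq.le hw0)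
  rw [h1]
  exact (Metric.measure_ball_pos volume c hr).ne'

/-- The almost everywhere differentiability of functions of finite weighted Riesz variation. -/
theorem MemRBV.ae_differentiableAt {p : ℝ} (hp : 1 ≤ p) (hw : IsMuckenhoupt p w)
    (hw0 : ¬ w =ᵐ[volume] 0) {f : EuclideanSpace ℝ (Fin n) → ℝ} (hf : MemRBV p w f) :
    ∀ᵐ x ∂volume, DifferentiableAt ℝ f x := by
  have h1 := hf.ae_isBigO hp
  rw [weightMeasure, ae_withDensity_iff' hw.isWeight.aemeasurable.ennreal_ofReal] at h1
  filter_upwards [h1, hw.ae_ne_zero hp hw0, ae_differentiableAt_of_isBigO volume f]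
    with x hx hx0 hxd
  exact hxd (hx (by simpa using lt_of_le_of_ne (hw.isWeight.nonneg x) hx0.symm))

/-- A Muckenhoupt weight belongs to some class `A_q` with `1 < q` and `n q < p` as soon as
`n r_w < p`. -/
theorem exists_isMuckenhoupt_of_criticalIndex_lt (hn : n ≠ 0) {p : ℝ} (hp : 1 ≤ p)
    (hw : IsMuckenhoupt p w) (h : (n : ℝ) * criticalIndex w < p) :
    ∃ q, 1 < q ∧ IsMuckenhoupt q w ∧ n * q < p := by
  -- Needed because the real `sInf` of the empty set is the default `0`.
  have hne : {q : ℝ | 1 < q ∧ IsMuckenhoupt q w}.Nonempty := by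
    rcases hp.eq_or_lt with rfl | hp
    · exact ⟨2, one_lt_two, hw.two_of_one⟩
    · exact ⟨p, hp, hw⟩
  have hn' : (0 : ℝ) < n := by positivity
  rw [← lt_div_iff₀' hn'] at h
  obtain ⟨q, ⟨hq1, hq⟩, hqp⟩ := exists_lt_of_csInf_lt hne h
  exact ⟨q, hq1, hq, (lt_div_iff₀' hn').mp hqp⟩

end WeightedRBV

/-! ### Morrey's Dirichlet growth estimate for `C¹` functions. -/

section Morrey

theorem lintegral_comp_add_smul {E : Type*} [NormedAddCommGroup E] [NormedSpace ℝ E]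
    [FiniteDimensional ℝ E] [MeasurableSpace E] [BorelSpace E] (μ : Measure E)
    [μ.IsAddHaarMeasure] {F : E → ℝ≥0∞} (hF : Measurable F) (b : E) {t : ℝ} (ht : t ≠ 0) :
    ∫⁻ z, F (b + t • z) ∂μ =
      ENNReal.ofReal |(t ^ Module.finrank ℝ E)⁻¹| * ∫⁻ y, F y ∂μ := by
  have hm : Measurable fun y => F (b + y) := hF.comp (measurable_const_add b)
  calc ∫⁻ z, F (b + t • z) ∂μ = ∫⁻ y, F (b + y) ∂(Measure.map (t • ·) μ) :=
        (lintegral_map hm (measurable_const_smul t)).symm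
    _ = _ := by
        rw [Measure.map_addHaar_smul μ ht, lintegral_smul_measure,
          lintegral_add_left_eq_self F b, smul_eq_mul]

theorem setLIntegral_ball_comp_homothety {E : Type*} [NormedAddCommGroup E] [NormedSpace ℝ E]
    [FiniteDimensional ℝ E] [MeasurableSpace E] [BorelSpace E] (μ : Measure E)
    [μ.IsAddHaarMeasure] {F : E → ℝ≥0∞} (hF : Measurable F) (x c : E) (r : ℝ) {t : ℝ}
    (ht : 0 < t) :
    ∫⁻ z in Metric.ball c r, F (x + t • (z - x)) ∂μ =
      ENNReal.ofReal (t ^ Module.finrank ℝ E)⁻¹ *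
        ∫⁻ y in Metric.ball (x + t • (c - x)) (t * r), F y ∂μ := by
  rw [← lintegral_indicator measurableSet_ball,
    ← lintegral_indicator measurableSet_ball]
  have h := lintegral_comp_add_smul μ (hF.indicator
    (measurableSet_ball (x := x + t • (c - x)) (ε := t * r))) (x - t • x) ht.ne'
  rw [abs_of_pos (by positivity)] at h
  rw [← h]
  refine lintegral_congr fun z => ?_
  have h1 : x - t • x + t • z = x + t • (z - x) := by rw [smul_sub]; abel
  have h2 : x + t • (z - x) ∈ Metric.ball (x + t • (c - x)) (t * r) ↔ z ∈ Metric.ball c r := by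
    rw [Metric.mem_ball, Metric.mem_ball, dist_add_left, dist_smul₀, dist_sub_right,
      Real.norm_of_nonneg ht.le]
    exact mul_lt_mul_iff_right₀ ht
  rw [h1]
  by_cases hz : z ∈ Metric.ball c r
  · rw [Set.indicator_of_mem hz, Set.indicator_of_mem (h2.mpr hz)]
  · rw [Set.indicator_of_notMem hz, Set.indicator_of_notMem (fun h => hz (h2.mp h))]

/-- The fundamental theorem of calculus along the segment from `x` to `z`. -/
theorem enorm_sub_le_lintegral_fderiv {E : Type*} [NormedAddCommGroup E] [NormedSpace ℝ E]
    {u : E → ℝ} (hu : ContDiff ℝ 1 u) (x z : E) :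
    ‖u z - u x‖ₑ ≤ ∫⁻ t in Set.Ioc (0 : ℝ) 1, ‖fderiv ℝ u (x + t • (z - x))‖ₑ * ‖z - x‖ₑ := by
  have hline : ∀ t : ℝ, HasDerivAt (fun t : ℝ => x + t • (z - x)) (z - x) t := fun t => by
    simpa using ((hasDerivAt_id t).smul_const (z - x)).const_add x
  have hd : ∀ t : ℝ, HasDerivAt (fun t : ℝ => u (x + t • (z - x)))
      (fderiv ℝ u (x + t • (z - x)) (z - x)) t := fun t =>
    ((hu.differentiable (by norm_num)) _).hasFDerivAt.comp_hasDerivAt t (hline t)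
  have hc : Continuous fun t : ℝ => fderiv ℝ u (x + t • (z - x)) (z - x) :=
    ((hu.continuous_fderiv (by norm_num)).comp (by fun_prop)).clm_apply continuous_const
  have h1 := intervalIntegral.integral_eq_sub_of_hasDerivAt (a := 0) (b := 1)
    (fun t _ => hd t) (hc.intervalIntegrable 0 1)
  simp only [one_smul, zero_smul, add_zero, add_sub_cancel] at h1
  rw [← h1, intervalIntegral.integral_of_le zero_le_one]
  refine (enorm_integral_le_lintegral_enorm _).trans (lintegral_mono fun t => ?_)
  exact ContinuousLinearMap.le_opENorm _ _

/-- Source of the factor `1 / α` in Morrey's constant; `α > 0` is what makes the singularity at `0`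
integrable. -/
theorem lintegral_Ioc_rpow_sub_one {α : ℝ} (hα : 0 < α) :
    ∫⁻ t in Set.Ioc (0 : ℝ) 1, ENNReal.ofReal (t ^ (α - 1)) = ENNReal.ofReal (1 / α) := by
  have hint : IntervalIntegrable (fun t : ℝ => t ^ (α - 1)) volume 0 1 :=
    intervalIntegral.intervalIntegrable_rpow' (by linarith)
  rw [← ofReal_integral_eq_lintegral_ofReal hint.1]
  · rw [← intervalIntegral.integral_of_le zero_le_one, integral_rpow (Or.inl (by linarith))]
    simp [hα.ne']
  · filter_upwards [ae_restrict_mem measurableSet_Ioc] with t ht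
    exact Real.rpow_nonneg ht.1.le _

variable {n : ℕ}

/-- Mean oscillation estimate behind Morrey's Dirichlet growth theorem. -/
theorem lintegral_enorm_sub_le_of_growth {u : EuclideanSpace ℝ (Fin n) → ℝ}
    (hu : ContDiff ℝ 1 u) {c x : EuclideanSpace ℝ (Fin n)} {r α : ℝ} (hα : 0 < α) {K : ℝ≥0∞}
    (hK : ∀ a ρ, 0 < ρ → Metric.ball a ρ ⊆ Metric.ball c r →
      ∫⁻ z in Metric.ball a ρ, ‖fderiv ℝ u z‖ₑ ≤ K * ENNReal.ofReal (ρ ^ (n - 1 + α)))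
    (hx : x ∈ Metric.ball c r) :
    ∫⁻ z in Metric.ball c r, ‖u z - u x‖ₑ ≤
      K * ENNReal.ofReal (2 / α * r ^ (n + α)) := by
  have hr : 0 < r := Metric.pos_of_mem_ball hx
  have hcont : Continuous fun z => ‖fderiv ℝ u z‖ₑ :=
    (hu.continuous_fderiv (by norm_num)).enorm
  -- The homothety centred at `x` shrinks `B(c, r)` to a ball of radius `t r` that stays inside by
  -- convexity. The Jacobian `t ^ (-n)` times the growth `(t r) ^ (n - 1 + α)` leaves `t ^ (α - 1)`.
  have hinner : ∀ t ∈ Set.Ioc (0 : ℝ) 1,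
      ∫⁻ z in Metric.ball c r, ‖fderiv ℝ u (x + t • (z - x))‖ₑ ≤
        K * ENNReal.ofReal (r ^ (n - 1 + α)) * ENNReal.ofReal (t ^ (α - 1)) := by
    intro t ht
    rw [setLIntegral_ball_comp_homothety volume hcont.measurable x c r ht.1,
      finrank_euclideanSpace_fin]
    have hsub : Metric.ball (x + t • (c - x)) (t * r) ⊆ Metric.ball c r := by
      refine Metric.ball_subset_ball' ?_
      have h1 : x + t • (c - x) - c = (1 - t) • (x - c) := by
        rw [sub_smul, one_smul, smul_sub, smul_sub]; abel
      rw [dist_eq_norm, h1, norm_smul, Real.norm_of_nonneg (by linarith [ht.2])]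
      rw [Metric.mem_ball, dist_eq_norm] at hx
      nlinarith [ht.2, ht.1]
    calc _ ≤ ENNReal.ofReal (t ^ n)⁻¹ * (K * ENNReal.ofReal ((t * r) ^ (n - 1 + α))) := by
          gcongr
          exact hK _ _ (mul_pos ht.1 hr) hsub
      _ = K * (ENNReal.ofReal (t ^ n)⁻¹ * ENNReal.ofReal ((t * r) ^ (n - 1 + α))) := by ring
      _ = K * (ENNReal.ofReal (r ^ (n - 1 + α)) * ENNReal.ofReal (t ^ (α - 1))) := by
          have := ht.1
          rw [← ENNReal.ofReal_mul (by positivity), ← ENNReal.ofReal_mul (by positivity)]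
          congr 2
          rw [Real.mul_rpow this.le hr.le, ← Real.rpow_natCast, ← Real.rpow_neg this.le,
            ← mul_assoc, ← Real.rpow_add this, mul_comm]
          congr 2
          ring
      _ = _ := by ring
  calc ∫⁻ z in Metric.ball c r, ‖u z - u x‖ₑ
      ≤ ∫⁻ z in Metric.ball c r, ∫⁻ t in Set.Ioc (0 : ℝ) 1,
          ‖fderiv ℝ u (x + t • (z - x))‖ₑ * ENNReal.ofReal (2 * r) := by
        refine setLIntegral_mono_ae' measurableSet_ball (ae_of_all _ fun z hz => ?_)
        refine (enorm_sub_le_lintegral_fderiv hu x z).trans (lintegral_mono fun t => ?_)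
        gcongr
        rw [← ofReal_norm]
        refine ENNReal.ofReal_le_ofReal ?_
        rw [← dist_eq_norm]
        have := dist_triangle_right z x c
        rw [Metric.mem_ball] at hz hx
        linarith
    _ = ∫⁻ t in Set.Ioc (0 : ℝ) 1, ∫⁻ z in Metric.ball c r,
          ‖fderiv ℝ u (x + t • (z - x))‖ₑ * ENNReal.ofReal (2 * r) := by
        refine lintegral_lintegral_swap (Continuous.aemeasurable ?_)
        refine ENNReal.continuous_mul_const ENNReal.ofReal_ne_top |>.comp
          (hcont.comp ?_)
        fun_prop
    _ ≤ ∫⁻ t in Set.Ioc (0 : ℝ) 1, K * ENNReal.ofReal (r ^ (n - 1 + α)) *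
          ENNReal.ofReal (2 * r) * ENNReal.ofReal (t ^ (α - 1)) := by
        refine setLIntegral_mono_ae' measurableSet_Ioc (ae_of_all _ fun t ht => ?_)
        rw [lintegral_mul_const' _ _ ENNReal.ofReal_ne_top]
        calc _ ≤ K * ENNReal.ofReal (r ^ (n - 1 + α)) * ENNReal.ofReal (t ^ (α - 1)) *
              ENNReal.ofReal (2 * r) := by
              gcongr
              exact hinner t ht
          _ = _ := by ring
    _ = K * ENNReal.ofReal (2 / α * r ^ (n + α)) := by
        rw [lintegral_const_mul _ (by fun_prop), lintegral_Ioc_rpow_sub_one hα, mul_assoc, mul_assoc,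
          ← ENNReal.ofReal_mul (by positivity), ← ENNReal.ofReal_mul (by positivity)]
        congr 2
        have : r ^ (n + α) = r ^ (n - 1 + α) * r := by
          rw [← Real.rpow_add_one hr.ne']; congr 1; ring
        rw [this]
        field_simp

/-- **Morrey's Dirichlet growth theorem** for smooth functions. -/
theorem enorm_sub_le_of_growth {u : EuclideanSpace ℝ (Fin n) → ℝ}
    (hu : ContDiff ℝ 1 u) {c x y : EuclideanSpace ℝ (Fin n)} {r α : ℝ} (hα : 0 < α) {K : ℝ≥0∞}
    (hK : ∀ a ρ, 0 < ρ → Metric.ball a ρ ⊆ Metric.ball c r →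
      ∫⁻ z in Metric.ball a ρ, ‖fderiv ℝ u z‖ₑ ≤ K * ENNReal.ofReal (ρ ^ (n - 1 + α)))
    (hx : x ∈ Metric.ball c r) (hy : y ∈ Metric.ball c r) :
    ‖u x - u y‖ₑ ≤ K * (ENNReal.ofReal (4 / α * r ^ α) /
      volume (Metric.ball (0 : EuclideanSpace ℝ (Fin n)) 1)) := by
  have hr : 0 < r := Metric.pos_of_mem_ball hx
  have hV : volume (Metric.ball (0 : EuclideanSpace ℝ (Fin n)) 1) ≠ 0 :=
    (Metric.measure_ball_pos _ _ one_pos).ne'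
  have hV' : volume (Metric.ball (0 : EuclideanSpace ℝ (Fin n)) 1) ≠ ⊤ := measure_ball_lt_top.ne
  -- Averaging over an intermediate point `z` uses the mean estimate at both `x` and `y`, whence `4
  -- / α` in place of `2 / α`.
  have hmul : ‖u x - u y‖ₑ * volume (Metric.ball c r) ≤
      K * ENNReal.ofReal (4 / α * r ^ (n + α)) := by
    calc ‖u x - u y‖ₑ * volume (Metric.ball c r) = ∫⁻ z in Metric.ball c r, ‖u x - u y‖ₑ := by
          rw [setLIntegral_const]
      _ ≤ ∫⁻ z in Metric.ball c r, (‖u z - u y‖ₑ + ‖u z - u x‖ₑ) := by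
          refine lintegral_mono fun z => ?_
          have : u x - u y = (u z - u y) - (u z - u x) := by ring
          rw [this]
          exact enorm_sub_le
      _ = (∫⁻ z in Metric.ball c r, ‖u z - u y‖ₑ) + ∫⁻ z in Metric.ball c r, ‖u z - u x‖ₑ :=
          lintegral_add_left (hu.continuous.sub continuous_const).enorm.measurable _
      _ ≤ K * ENNReal.ofReal (2 / α * r ^ (n + α)) + K * ENNReal.ofReal (2 / α * r ^ (n + α)) :=
          add_le_add (lintegral_enorm_sub_le_of_growth hu hα hK hy)
            (lintegral_enorm_sub_le_of_growth hu hα hK hx)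
      _ = _ := by
          rw [← mul_add, ← ENNReal.ofReal_add (by positivity) (by positivity)]
          congr 2
          ring
  rw [Measure.addHaar_ball_of_pos _ _ hr, finrank_euclideanSpace_fin] at hmul
  have hrn : ENNReal.ofReal (r ^ n) ≠ 0 := by simpa using pow_pos hr n
  rw [← mul_div_assoc, ENNReal.le_div_iff_mul_le (Or.inl hV) (Or.inl hV')]
  refine (ENNReal.mul_le_mul_iff_right hrn ENNReal.ofReal_ne_top).mp ?_
  calc _ = ‖u x - u y‖ₑ * (ENNReal.ofReal (r ^ n) * volume (Metric.ball 0 1)) := by ring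
    _ ≤ _ := hmul
    _ = K * (ENNReal.ofReal (r ^ n) * ENNReal.ofReal (4 / α * r ^ α)) := by
        rw [← ENNReal.ofReal_mul (by positivity), Real.rpow_add hr, Real.rpow_natCast]
        congr 2
        ring
    _ = _ := by ring

end Morrey

/-! ### Mollification and Morrey's theorem for weak derivatives. -/

section Mollification
open scoped Convolution
open ContinuousLinearMap (lsmul)

variable {n : ℕ}

/-- Mollification commutes with weak differentiation. -/
theorem WeightedRBV.IsWeakPartialDeriv.fderiv_convolution {j : Fin n}
    {f g : EuclideanSpace ℝ (Fin n) → ℝ} (h : WeightedRBV.IsWeakPartialDeriv j f g)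
    {ψ : EuclideanSpace ℝ (Fin n) → ℝ} (hψ : ContDiff ℝ ∞ ψ) (hψc : HasCompactSupport ψ)
    (x : EuclideanSpace ℝ (Fin n)) :
    fderiv ℝ (ψ ⋆[lsmul ℝ ℝ, volume] f) x (EuclideanSpace.single j 1) =
      (ψ ⋆[lsmul ℝ ℝ, volume] g) x := by
  have hψ1 : ContDiff ℝ 1 ψ := hψ.of_le (by exact_mod_cast le_top)
  -- The flip puts `ψ` on the right, where the differentiation formula lets the derivative fall on
  -- it.
  rw [← convolution_flip, (hψc.hasFDerivAt_convolution_right (lsmul ℝ ℝ).flip h.locallyIntegrable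
    hψ1 x).fderiv, convolution_precompR_apply (lsmul ℝ ℝ).flip h.locallyIntegrable (hψc.fderiv ℝ)
    (hψ1.continuous_fderiv one_ne_zero), ← convolution_flip (f := ψ) (g := g)]
  simp only [convolution_def, ContinuousLinearMap.flip_apply, ContinuousLinearMap.lsmul_apply,
    smul_eq_mul]
  have hd : ∀ t, fderiv ℝ (fun t => ψ (x - t)) t (EuclideanSpace.single j 1) =
      - fderiv ℝ ψ (x - t) (EuclideanSpace.single j 1) := by
    intro t
    have h1 : HasFDerivAt (fun t => x - t)
        (-ContinuousLinearMap.id ℝ (EuclideanSpace ℝ (Fin n))) t :=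
      (hasFDerivAt_id t).const_sub x
    have h2 := ((hψ1.differentiable one_ne_zero) (x - t)).hasFDerivAt.comp t h1
    have h3 : fderiv ℝ (fun t => ψ (x - t)) t = _ := h2.fderiv
    rw [h3]
    simp
  -- The reflection in `t ↦ ψ (x - t)` produces a sign that cancels the one in the weak derivative.
  have h4 := h.integral_eq (fun t => ψ (x - t)) (hψ.comp (contDiff_const.sub contDiff_id))
    (hψc.comp_homeomorph (Homeomorph.subLeft x))
  simp only [hd, mul_neg, integral_neg, neg_inj] at h4
  simpa only [mul_comm] using h4

/-- The local `L¹` norms of a mollification are controlled by those of the translates. -/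
theorem lintegral_enorm_convolution_le {E : Type*} [NormedAddCommGroup E] [NormedSpace ℝ E]
    [FiniteDimensional ℝ E] [MeasurableSpace E] [BorelSpace E] {μ : Measure E}
    [μ.IsAddHaarMeasure] (φ : ContDiffBump (0 : E)) {g : E → ℝ} (hg : AEStronglyMeasurable g μ)
    {a : E} {ρ : ℝ} {M : ℝ≥0∞}
    (hM : ∀ h ∈ Metric.ball (0 : E) φ.rOut, ∫⁻ z in Metric.ball (a - h) ρ, ‖g z‖ₑ ∂μ ≤ M) :
    ∫⁻ z in Metric.ball a ρ, ‖(φ.normed μ ⋆[lsmul ℝ ℝ, μ] g) z‖ₑ ∂μ ≤ M := by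
  have hmeas : AEMeasurable (Function.uncurry fun z h : E => ‖φ.normed μ h • g (z - h)‖ₑ)
      ((μ.restrict (Metric.ball a ρ)).prod μ) :=
    ((φ.continuous_normed.aestronglyMeasurable.convolution_integrand (lsmul ℝ ℝ)
      hg).mono_ac (Measure.restrict_le_self.absolutelyContinuous.prod
        Measure.AbsolutelyContinuous.rfl)).enorm
  calc ∫⁻ z in Metric.ball a ρ, ‖(φ.normed μ ⋆[lsmul ℝ ℝ, μ] g) z‖ₑ ∂μ
      ≤ ∫⁻ z in Metric.ball a ρ, ∫⁻ h, ‖φ.normed μ h • g (z - h)‖ₑ ∂μ ∂μ :=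
        lintegral_mono fun z => enorm_integral_le_lintegral_enorm _
    _ = ∫⁻ h, ∫⁻ z in Metric.ball a ρ, ‖φ.normed μ h • g (z - h)‖ₑ ∂μ ∂μ :=
        lintegral_lintegral_swap hmeas
    _ ≤ ∫⁻ h, ‖φ.normed μ h‖ₑ * M ∂μ := by
        refine lintegral_mono fun h => ?_
        simp only [smul_eq_mul, enorm_mul]
        rw [lintegral_const_mul' _ _ enorm_ne_top]
        by_cases hh : h ∈ Metric.ball (0 : E) φ.rOut
        · gcongr
          refine le_trans (le_of_eq ?_) (hM h hh)
          rw [← lintegral_indicator measurableSet_ball, ← lintegral_indicator measurableSet_ball,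
            ← lintegral_sub_right_eq_self ((Metric.ball (a - h) ρ).indicator fun z => ‖g z‖ₑ) h]
          refine lintegral_congr fun z => ?_
          have h1 : z - h ∈ Metric.ball (a - h) ρ ↔ z ∈ Metric.ball a ρ := by
            rw [Metric.mem_ball, Metric.mem_ball, dist_sub_right]
          by_cases hz : z ∈ Metric.ball a ρ
          · rw [Set.indicator_of_mem hz, Set.indicator_of_mem (h1.mpr hz)]
          · rw [Set.indicator_of_notMem hz, Set.indicator_of_notMem (fun h => hz (h1.mp h))]
        · rw [← φ.support_normed_eq (μ := μ), Function.notMem_support] at hh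
          simp [hh]
    _ = M := by
        rw [lintegral_mul_const _ φ.continuous_normed.enorm.measurable,
          ← ofReal_integral_norm_eq_lintegral_enorm φ.integrable_normed]
        simp only [Real.norm_of_nonneg (φ.nonneg_normed _), φ.integral_normed, ENNReal.ofReal_one,
          one_mul]

/-- Passes from coordinate derivatives to the full differential; this costs the factor `n` in
`morreyConst`. -/
theorem enorm_le_sum_enorm_single (L : EuclideanSpace ℝ (Fin n) →L[ℝ] ℝ) :
    ‖L‖ₑ ≤ ∑ j, ‖L (EuclideanSpace.single j 1)‖ₑ := by
  have h : ‖L‖ ≤ ∑ j, ‖L (EuclideanSpace.single j 1)‖ := by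
    refine L.opNorm_le_bound (Finset.sum_nonneg fun _ _ => norm_nonneg _) fun x => ?_
    have hx : x = ∑ j, x j • EuclideanSpace.single j (1 : ℝ) := by
      ext i
      simp [Finset.sum_apply, Pi.single_apply]
    calc ‖L x‖ = ‖∑ j, x j • L (EuclideanSpace.single j (1 : ℝ))‖ := by
          conv_lhs => rw [hx]
          simp only [map_sum, map_smul]
      _ ≤ ∑ j, ‖x j • L (EuclideanSpace.single j (1 : ℝ))‖ := norm_sum_le _ _
      _ ≤ ∑ j, ‖L (EuclideanSpace.single j 1)‖ * ‖x‖ := by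
          refine Finset.sum_le_sum fun j _ => ?_
          rw [norm_smul, mul_comm]
          gcongr
          exact PiLp.norm_apply_le x j
      _ = _ := (Finset.sum_mul _ _ _).symm
  calc ‖L‖ₑ = ENNReal.ofReal ‖L‖ := (ofReal_norm L).symm
    _ ≤ ENNReal.ofReal (∑ j, ‖L (EuclideanSpace.single j 1)‖) := ENNReal.ofReal_le_ofReal h
    _ = _ := by
        rw [ENNReal.ofReal_sum_of_nonneg fun _ _ => norm_nonneg _]
        simp only [ofReal_norm]

/-- The Morrey-type growth condition `∫_{B(a,ρ)} |g_j| ≤ K ρ^{n-1+α}` for all balls contained in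
`B(c,r)`. -/
def HasMorreyGrowth (g : Fin n → EuclideanSpace ℝ (Fin n) → ℝ) (α : ℝ)
    (c : EuclideanSpace ℝ (Fin n)) (r : ℝ) (K : ℝ≥0∞) : Prop :=
  ∀ j a ρ, 0 < ρ → Metric.ball a ρ ⊆ Metric.ball c r →
    ∫⁻ z in Metric.ball a ρ, ‖g j z‖ₑ ≤ K * ENNReal.ofReal (ρ ^ (n - 1 + α))

/-- The constant of Morrey's inequality. -/
noncomputable def morreyConst (n : ℕ) (α : ℝ) : ℝ≥0∞ :=
  n * (ENNReal.ofReal (4 / α) / volume (Metric.ball (0 : EuclideanSpace ℝ (Fin n)) 1))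

theorem morreyConst_ne_top (n : ℕ) (α : ℝ) : morreyConst n α ≠ ⊤ :=
  ENNReal.mul_ne_top (ENNReal.natCast_ne_top n) (ENNReal.div_ne_top ENNReal.ofReal_ne_top
    (Metric.measure_ball_pos _ _ one_pos).ne')

/-- Morrey's inequality for mollifications, uniformly in the mollification parameter. -/
theorem enorm_convolution_sub_le_of_growth {f : EuclideanSpace ℝ (Fin n) → ℝ}
    (hf : LocallyIntegrable f volume)
    {g : Fin n → EuclideanSpace ℝ (Fin n) → ℝ}
    (hg : ∀ j, WeightedRBV.IsWeakPartialDeriv j f (g j)) {α : ℝ} (hα : 0 < α)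
    {c x y : EuclideanSpace ℝ (Fin n)} {r : ℝ} {K : ℝ≥0∞} (hK : HasMorreyGrowth g α c (2 * r) K)
    (φ : ContDiffBump (0 : EuclideanSpace ℝ (Fin n))) (hφ : φ.rOut ≤ r)
    (hx : x ∈ Metric.ball c r) (hy : y ∈ Metric.ball c r) :
    ‖(φ.normed volume ⋆[lsmul ℝ ℝ, volume] f) x - (φ.normed volume ⋆[lsmul ℝ ℝ, volume] f) y‖ₑ ≤
      morreyConst n α * (K * ENNReal.ofReal (r ^ α)) := by
  have hu : ContDiff ℝ 1 (φ.normed volume ⋆[lsmul ℝ ℝ, volume] f) :=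
    φ.hasCompactSupport_normed.contDiff_convolution_left (n := 1) _ φ.contDiff_normed hf
  refine (enorm_sub_le_of_growth hu hα (K := n * K) (fun a ρ hρ hsub => ?_) hx hy).trans ?_
  · calc ∫⁻ z in Metric.ball a ρ, ‖fderiv ℝ (φ.normed volume ⋆[lsmul ℝ ℝ, volume] f) z‖ₑ
        ≤ ∫⁻ z in Metric.ball a ρ, ∑ j, ‖(φ.normed volume ⋆[lsmul ℝ ℝ, volume] g j) z‖ₑ := by
          refine lintegral_mono fun z => (enorm_le_sum_enorm_single _).trans (le_of_eq ?_)
          refine Finset.sum_congr rfl fun j _ => ?_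
          rw [(hg j).fderiv_convolution φ.contDiff_normed φ.hasCompactSupport_normed]
      _ = ∑ j, ∫⁻ z in Metric.ball a ρ, ‖(φ.normed volume ⋆[lsmul ℝ ℝ, volume] g j) z‖ₑ := by
          refine lintegral_finsetSum' _ fun j _ => ?_
          exact (φ.hasCompactSupport_normed.contDiff_convolution_left (n := 0) _ φ.contDiff_normed
            (hg j).locallyIntegrable_deriv).continuous.enorm.aemeasurable
      _ ≤ ∑ _j : Fin n, K * ENNReal.ofReal (ρ ^ (n - 1 + α)) := by
          -- Translation by less than `φ.rOut ≤ r` keeps the balls inside `B(c, 2r)`, hence the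
          -- doubled radius in `hK`.
          refine Finset.sum_le_sum fun j _ => ?_
          refine lintegral_enorm_convolution_le φ
            (hg j).locallyIntegrable_deriv.aestronglyMeasurable fun h hh => hK j _ _ hρ ?_
          intro z hz
          have h1 : z + h ∈ Metric.ball a ρ := by
            rw [Metric.mem_ball, dist_eq_norm] at hz ⊢
            rwa [show z + h - a = z - (a - h) by abel]
          have h2 := hsub h1
          rw [Metric.mem_ball, dist_eq_norm] at h2 ⊢
          rw [mem_ball_zero_iff] at hh
          calc ‖z - c‖ = ‖(z + h - c) - h‖ := by congr 1; abel
            _ ≤ ‖z + h - c‖ + ‖h‖ := norm_sub_le _ _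
            _ < 2 * r := by linarith
      _ = _ := by simp [mul_assoc]
  · rw [morreyConst, ENNReal.ofReal_mul (by positivity)]
    refine le_of_eq ?_
    simp only [div_eq_mul_inv]
    ring

theorem HasMorreyGrowth.mono {g : Fin n → EuclideanSpace ℝ (Fin n) → ℝ} {α : ℝ}
    {c : EuclideanSpace ℝ (Fin n)} {r r' : ℝ} {K : ℝ≥0∞} (h : HasMorreyGrowth g α c r K)
    (hr : r' ≤ r) : HasMorreyGrowth g α c r' K :=
  fun j a ρ hρ hsub => h j a ρ hρ (hsub.trans (Metric.ball_subset_ball hr))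

/-- Morrey's theorem: a function whose weak derivatives locally satisfy a Morrey growth condition
has a representative with the corresponding local Hölder estimates. -/
theorem exists_ae_eq_forall_enorm_sub_le {f : EuclideanSpace ℝ (Fin n) → ℝ}
    (hf : LocallyIntegrable f volume)
    {g : Fin n → EuclideanSpace ℝ (Fin n) → ℝ}
    (hg : ∀ j, WeightedRBV.IsWeakPartialDeriv j f (g j)) {α : ℝ} (hα : 0 < α)
    (hloc : ∀ c, ∃ r > 0, ∃ K : ℝ≥0∞, K ≠ ⊤ ∧ HasMorreyGrowth g α c r K) :
    ∃ h : EuclideanSpace ℝ (Fin n) → ℝ, h =ᵐ[volume] f ∧ Continuous h ∧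
      ∀ c r K, HasMorreyGrowth g α c (2 * r) K → ∀ x ∈ Metric.ball c r,
        ∀ y ∈ Metric.ball c r, ‖h x - h y‖ₑ ≤ morreyConst n α * (K * ENNReal.ofReal (r ^ α)) := by
  -- The fixed ratio `rOut / rIn = 2` is what the almost everywhere convergence of mollifications
  -- requires.
  let φ : ℕ → ContDiffBump (0 : EuclideanSpace ℝ (Fin n)) := fun k =>
    ⟨1 / (k + 1) / 2, 1 / (k + 1), by positivity, half_lt_self (by positivity)⟩
  have hφ : Tendsto (fun k => (φ k).rOut) atTop (𝓝 0) := tendsto_one_div_add_atTop_nhds_zero_nat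
  let u : ℕ → EuclideanSpace ℝ (Fin n) → ℝ := fun k =>
    (φ k).normed volume ⋆[lsmul ℝ ℝ, volume] f
  have hae : ∀ᵐ x ∂volume, Tendsto (fun k => u k x) atTop (𝓝 (f x)) :=
    ContDiffBump.ae_convolution_tendsto_right_of_locallyIntegrable (K := 2) hφ
      (Eventually.of_forall fun k => by simp only [φ]; linarith) hf
  have hest : ∀ c r K, HasMorreyGrowth g α c (2 * r) K → ∀ x ∈ Metric.ball c r,
      ∀ y ∈ Metric.ball c r, ∀ᶠ k in atTop,
        ‖u k x - u k y‖ₑ ≤ morreyConst n α * (K * ENNReal.ofReal (r ^ α)) := by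
    intro c r K hK x hx y hy
    filter_upwards [hφ.eventually (Iic_mem_nhds (Metric.pos_of_mem_ball hx))] with k hk
    exact enorm_convolution_sub_le_of_growth hf hg hα hK (φ k) hk hx hy
  -- around every point the estimate becomes arbitrarily small
  have hsmall : ∀ c, ∀ ε > (0 : ℝ), ∃ r > 0, ∃ K : ℝ≥0∞, K ≠ ⊤ ∧ HasMorreyGrowth g α c (2 * r) K ∧
      morreyConst n α * (K * ENNReal.ofReal (r ^ α)) ≤ ENNReal.ofReal ε := by
    intro c ε hε
    obtain ⟨r₀, hr₀, K, hKt, hK⟩ := hloc c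
    have hlim : Tendsto (fun r : ℝ => morreyConst n α * (K * ENNReal.ofReal (r ^ α))) (𝓝[>] 0)
        (𝓝 0) := by
      have h1 : Tendsto (fun r : ℝ => r ^ α) (𝓝[>] 0) (𝓝 0) := by
        have := (Real.continuousAt_rpow_const 0 α (Or.inr hα.le)).tendsto
        rw [Real.zero_rpow hα.ne'] at this
        exact this.mono_left nhdsWithin_le_nhds
      have h2 := ENNReal.Tendsto.const_mul (a := K) (ENNReal.tendsto_ofReal h1) (Or.inr hKt)
      have h3 := ENNReal.Tendsto.const_mul (a := morreyConst n α) h2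
        (Or.inr (morreyConst_ne_top n α))
      simpa using h3
    have h4 : ∀ᶠ r : ℝ in 𝓝[>] 0, r ∈ Set.Ioo 0 (r₀ / 2) :=
      Ioo_mem_nhdsGT (by positivity)
    obtain ⟨r, hr, hrε⟩ := (h4.and (hlim.eventually (Iic_mem_nhds
      (ENNReal.ofReal_pos.mpr hε)))).exists
    exact ⟨r, hr.1, K, hKt, hK.mono (by linarith [hr.2]), hrε⟩
  -- Convergence is known only a.e.; at an arbitrary `x` the sequence is compared with its values at
  -- a nearby good point `y`, using the estimate uniform in `k`.
  have hcauchy : ∀ x, CauchySeq fun k => u k x := by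
    intro x
    rw [Metric.cauchySeq_iff']
    intro ε hε
    obtain ⟨r, hr, K, -, hK, hKε⟩ := hsmall x (ε / 4) (by positivity)
    obtain ⟨y, hyr, hy⟩ := (Measure.dense_of_ae hae).exists_mem_open Metric.isOpen_ball
      ⟨x, Metric.mem_ball_self hr⟩
    have h1 : ∀ᶠ k in atTop, |u k x - u k y| ≤ ε / 4 := by
      filter_upwards [hest x r K hK x (Metric.mem_ball_self hr) y hy] with k hk
      have := hk.trans hKε
      rwa [← ofReal_norm, ENNReal.ofReal_le_ofReal_iff (by positivity)] at this
    have h2 : ∀ᶠ k in atTop, |u k y - f y| < ε / 8 := by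
      filter_upwards [hyr.eventually (Metric.ball_mem_nhds (f y) (by positivity : 0 < ε / 8))]
        with k hk
      exact hk
    obtain ⟨N, hN⟩ := eventually_atTop.mp (h1.and h2)
    refine ⟨N, fun k hk => ?_⟩
    obtain ⟨a1, a2⟩ := hN k hk
    obtain ⟨b1, b2⟩ := hN N le_rfl
    rw [Real.dist_eq]
    rw [abs_le] at a1 b1
    rw [abs_lt] at a2 b2 ⊢
    constructor <;> linarith [a1.1, a1.2, a2.1, a2.2, b1.1, b1.2, b2.1, b2.2]
  choose h hh using fun x => cauchySeq_tendsto_of_complete (hcauchy x)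
  have hmain : ∀ c r K, HasMorreyGrowth g α c (2 * r) K → ∀ x ∈ Metric.ball c r,
      ∀ y ∈ Metric.ball c r, ‖h x - h y‖ₑ ≤ morreyConst n α * (K * ENNReal.ofReal (r ^ α)) :=
    fun c r K hK x hx y hy => le_of_tendsto ((hh x).sub (hh y)).enorm (hest c r K hK x hx y hy)
  refine ⟨h, ?_, ?_, hmain⟩
  · filter_upwards [hae] with x hx
    exact tendsto_nhds_unique (hh x) hx
  · refine continuous_iff_continuousAt.mpr fun x => Metric.continuousAt_iff'.mpr fun ε hε => ?_
    obtain ⟨r, hr, K, -, hK, hKε⟩ := hsmall x (ε / 2) (by positivity)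
    filter_upwards [Metric.ball_mem_nhds x hr] with y hy
    have := (hmain x r K hK y hy x (Metric.mem_ball_self hr)).trans hKε
    rw [← ofReal_norm, ENNReal.ofReal_le_ofReal_iff (by positivity)] at this
    rw [dist_eq_norm]
    linarith

end Mollification

/-! ### Differentiability from weak derivatives in `L^s_loc` with `s > n`. -/

section SobolevDifferentiability

variable {n : ℕ}

/-- The measure `∑_j |g_j|^s dx`. -/
noncomputable def powerMeasure (s : ℝ) (g : Fin n → EuclideanSpace ℝ (Fin n) → ℝ) :
    Measure (EuclideanSpace ℝ (Fin n)) :=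
  volume.withDensity fun x => ∑ j, ‖g j x‖ₑ ^ s

/-- The Morrey growth constant of functions in `L^s`. -/
noncomputable def growthConst (s : ℝ) (g : Fin n → EuclideanSpace ℝ (Fin n) → ℝ)
    (c : EuclideanSpace ℝ (Fin n)) (r : ℝ) : ℝ≥0∞ :=
  powerMeasure s g (Metric.ball c r) ^ (1 / s) *
    volume (Metric.ball (0 : EuclideanSpace ℝ (Fin n)) 1) ^ (1 - 1 / s)

/-- Hölder's inequality against the constant `1`: the volume factor scales as `ρ ^ (n (1 - 1/s))`,
and `n - n/s = n - 1 + (1 - n/s)`. -/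
theorem hasMorreyGrowth_growthConst {g : Fin n → EuclideanSpace ℝ (Fin n) → ℝ}
    (hg : ∀ j, AEMeasurable (g j) volume) {s : ℝ} (hs : 1 < s)
    (c : EuclideanSpace ℝ (Fin n)) (r : ℝ) :
    HasMorreyGrowth g (1 - n / s) c r (growthConst s g c r) := by
  intro j a ρ hρ hsub
  have hs0 : 0 < s := zero_lt_one.trans hs
  have h1s : 0 ≤ 1 - 1 / s := by
    rw [sub_nonneg, div_le_one hs0]
    exact hs.le
  have hconj : s.HolderConjugate (s / (s - 1)) :=
    (Real.holderConjugate_iff_eq_conjExponent hs).mpr rfl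
  have hexp : 1 / (s / (s - 1)) = 1 - 1 / s := by
    field_simp
  have h1 := ENNReal.lintegral_mul_le_Lp_mul_Lq (volume.restrict (Metric.ball a ρ)) hconj
    (hg j).enorm.restrict (aemeasurable_const (b := (1 : ℝ≥0∞)))
  simp only [Pi.mul_apply, mul_one, ENNReal.one_rpow, lintegral_one, Measure.restrict_apply_univ,
    hexp] at h1
  refine h1.trans ?_
  have h2 : ∫⁻ z in Metric.ball a ρ, ‖g j z‖ₑ ^ s ≤ powerMeasure s g (Metric.ball c r) := by
    rw [powerMeasure, withDensity_apply _ measurableSet_ball]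
    refine (lintegral_mono_set hsub).trans (lintegral_mono fun z => ?_)
    exact Finset.single_le_sum (f := fun j => ‖g j z‖ₑ ^ s) (fun _ _ => zero_le) (Finset.mem_univ j)
  rw [Measure.addHaar_ball_of_pos _ _ hρ, finrank_euclideanSpace_fin,
    ENNReal.mul_rpow_of_nonneg _ _ h1s, ENNReal.ofReal_rpow_of_nonneg (by positivity) h1s]
  have h3 : (ρ ^ n) ^ (1 - 1 / s) = ρ ^ ((n : ℝ) - 1 + (1 - n / s)) := by
    rw [← Real.rpow_natCast, ← Real.rpow_mul hρ.le]
    congr 1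
    ring
  rw [h3, growthConst, mul_comm (ENNReal.ofReal _), ← mul_assoc]
  gcongr

theorem growthConst_ne_top {g : Fin n → EuclideanSpace ℝ (Fin n) → ℝ} {s : ℝ} (hs : 1 < s)
    {c : EuclideanSpace ℝ (Fin n)} {r : ℝ} (h : powerMeasure s g (Metric.ball c r) ≠ ⊤) :
    growthConst s g c r ≠ ⊤ := by
  have hs0 : 0 < s := zero_lt_one.trans hs
  refine ENNReal.mul_ne_top (ENNReal.rpow_ne_top_of_nonneg (by positivity) h)
    (ENNReal.rpow_ne_top_of_nonneg ?_ measure_ball_lt_top.ne)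
  rw [sub_nonneg, div_le_one hs0]
  exact hs.le

/-- A function with weak derivatives in `L^s_loc`, `s > n`, has a continuous representative which is
differentiable almost everywhere. -/
theorem exists_ae_eq_continuous_ae_differentiableAt {f : EuclideanSpace ℝ (Fin n) → ℝ}
    (hf : LocallyIntegrable f volume) {g : Fin n → EuclideanSpace ℝ (Fin n) → ℝ}
    (hg : ∀ j, WeightedRBV.IsWeakPartialDeriv j f (g j)) {s : ℝ} (hs : 1 < s) (hns : n < s)
    (hfin : ∀ c r, powerMeasure s g (Metric.ball c r) ≠ ⊤) :
    ∃ h : EuclideanSpace ℝ (Fin n) → ℝ, h =ᵐ[volume] f ∧ Continuous h ∧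
      ∀ᵐ x ∂volume, DifferentiableAt ℝ h x := by
  have hs0 : 0 < s := zero_lt_one.trans hs
  have hα : 0 < 1 - n / s := by
    rw [sub_pos, div_lt_one hs0]
    exact hns
  have hgm : ∀ j, AEMeasurable (g j) volume := fun j =>
    (hg j).locallyIntegrable_deriv.aestronglyMeasurable.aemeasurable
  obtain ⟨h, hhf, hhc, hh⟩ := exists_ae_eq_forall_enorm_sub_le hf hg hα fun c =>
    ⟨1, one_pos, _, growthConst_ne_top hs (hfin c 1), hasMorreyGrowth_growthConst hgm hs c 1⟩
  refine ⟨h, hhf, hhc, ?_⟩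
  have : IsLocallyFiniteMeasure (powerMeasure s g) :=
    ⟨fun x => ⟨Metric.ball x 1, Metric.ball_mem_nhds x one_pos, (hfin x 1).lt_top⟩⟩
  filter_upwards [ae_differentiableAt_of_isBigO volume h,
    Besicovitch.ae_tendsto_rnDeriv (powerMeasure s g) volume,
    (powerMeasure s g).rnDeriv_lt_top volume] with x hx hlim hlt
  refine hx ?_
  -- Any finite `D` above the density at `x` bounds the ratio `μ(B) / |B|` on all small balls
  -- centred at `x`.
  obtain ⟨D, hD1, hD2⟩ := ENNReal.lt_iff_exists_nnreal_btwn.mp hlt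
  have hev : ∀ᶠ r in 𝓝[>] (0 : ℝ),
      powerMeasure s g (Metric.closedBall x r) / volume (Metric.closedBall x r) < D :=
    hlim.eventually (Iio_mem_nhds hD1)
  obtain ⟨δ, hδ, hδD⟩ := mem_nhdsGT_iff_exists_Ioo_subset.mp hev
  set V := volume (Metric.ball (0 : EuclideanSpace ℝ (Fin n)) 1)
  set C : ℝ≥0∞ := morreyConst n (1 - n / s) * ((D * V) ^ (1 / s) * V ^ (1 - 1 / s) *
    ENNReal.ofReal (4 ^ (n / s) * 2 ^ (1 - n / s)))
  have hVt : V ≠ ⊤ := measure_ball_lt_top.ne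
  have hCt : C ≠ ⊤ := by
    refine ENNReal.mul_ne_top (morreyConst_ne_top _ _) (ENNReal.mul_ne_top (ENNReal.mul_ne_top
      (ENNReal.rpow_ne_top_of_nonneg (by positivity) (ENNReal.mul_ne_top ENNReal.coe_ne_top hVt))
      (ENNReal.rpow_ne_top_of_nonneg ?_ hVt)) ENNReal.ofReal_ne_top)
    rw [sub_nonneg, div_le_one hs0]
    exact hs.le
  refine Asymptotics.IsBigO.of_bound C.toReal ?_
  -- With `d = ‖y - x‖`, the ball of radius `2 d` contains `y` and Morrey's estimate doubles it to
  -- `4 d`, which must stay below `δ`.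
  filter_upwards [Metric.ball_mem_nhds x (div_pos hδ four_pos)] with y hy
  rcases eq_or_ne y x with rfl | hyx
  · simp
  set d := ‖y - x‖ with hd
  have hd0 : 0 < d := norm_pos_iff.mpr (sub_ne_zero.mpr hyx)
  rw [Metric.mem_ball, dist_eq_norm, ← hd] at hy
  have h1 := hh x (2 * d) _ (hasMorreyGrowth_growthConst hgm hs x _) y
    (by rw [Metric.mem_ball, dist_eq_norm]; linarith) x (Metric.mem_ball_self (by positivity))
  have h2 : powerMeasure s g (Metric.ball x (2 * (2 * d))) ≤
      D * V * ENNReal.ofReal ((4 * d) ^ n) := by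
    have h3 : powerMeasure s g (Metric.closedBall x (4 * d)) / volume (Metric.closedBall x (4 * d))
        < D := hδD ⟨by positivity, by linarith⟩
    rw [ENNReal.div_lt_iff (Or.inl (Metric.measure_closedBall_pos _ _ (by positivity)).ne')
      (Or.inl measure_closedBall_lt_top.ne), Measure.addHaar_closedBall volume _ (by positivity),
      finrank_euclideanSpace_fin] at h3
    rw [show 2 * (2 * d) = 4 * d by ring]
    refine (measure_mono Metric.ball_subset_closedBall).trans (h3.le.trans (le_of_eq ?_))
    ring
  have h4 : ‖h y - h x‖ₑ ≤ C * ENNReal.ofReal d := by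
    refine h1.trans ?_
    calc _ ≤ morreyConst n (1 - n / s) * ((D * V * ENNReal.ofReal ((4 * d) ^ n)) ^ (1 / s) *
          V ^ (1 - 1 / s) * ENNReal.ofReal ((2 * d) ^ (1 - n / s))) := by
          rw [growthConst]
          gcongr
      _ = morreyConst n (1 - n / s) * ((D * V) ^ (1 / s) * V ^ (1 - 1 / s) *
            (ENNReal.ofReal (((4 * d) ^ n) ^ (1 / s)) *
              ENNReal.ofReal ((2 * d) ^ (1 - n / s)))) := by
          rw [ENNReal.mul_rpow_of_nonneg _ _ (by positivity),
            ENNReal.ofReal_rpow_of_nonneg (by positivity) (by positivity)]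
          ring
      _ = C * ENNReal.ofReal d := by
          rw [← ENNReal.ofReal_mul (by positivity)]
          have h5 : ((4 * d) ^ n) ^ (1 / s) * (2 * d) ^ (1 - n / s) =
              4 ^ (n / s) * 2 ^ (1 - n / s) * d := by
            rw [← Real.rpow_natCast, ← Real.rpow_mul (by positivity), mul_one_div,
              Real.mul_rpow (by positivity) hd0.le, Real.mul_rpow (by positivity) hd0.le]
            have h6 : d ^ (n / s) * d ^ (1 - n / s) = d := by
              rw [← Real.rpow_add hd0, add_sub_cancel, Real.rpow_one]
            calc _ = 4 ^ (n / s) * 2 ^ (1 - n / s) * (d ^ (n / s) * d ^ (1 - n / s)) := by ring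
              _ = _ := by rw [h6]
          rw [h5, ENNReal.ofReal_mul (by positivity)]
          simp only [C]
          ring
  have h7 := ENNReal.toReal_mono (ENNReal.mul_ne_top hCt ENNReal.ofReal_ne_top) h4
  rwa [ENNReal.toReal_mul, ENNReal.toReal_ofReal hd0.le, toReal_enorm] at h7

end SobolevDifferentiability

/-! ### From weighted to unweighted local integrability. -/

namespace WeightedRBV

/-- Functions in `L^p(w)` with `w ∈ A_q` belong to `L^{p/q}_loc`. -/
theorem IsMuckenhoupt.lintegral_rpow_div_ne_top {n : ℕ} {w : EuclideanSpace ℝ (Fin n) → ℝ}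
    {p q : ℝ} (hp : 0 < p) (hq : 1 < q) (hw : IsMuckenhoupt q w) (hw0 : ¬ w =ᵐ[volume] 0)
    {g : EuclideanSpace ℝ (Fin n) → ℝ} (hgm : AEMeasurable g volume)
    (hg : MemLp g (ENNReal.ofReal p) (weightMeasure w)) (c : EuclideanSpace ℝ (Fin n)) (r : ℝ) :
    ∫⁻ x in Metric.ball c r, ‖g x‖ₑ ^ (p / q) ≠ ⊤ := by
  have hq0 : 0 < q := zero_lt_one.trans hq
  have hwm : AEMeasurable (fun x => ENNReal.ofReal (w x)) volume :=
    hw.isWeight.aemeasurable.ennreal_ofReal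
  have hconj : q.HolderConjugate (q / (q - 1)) :=
    (Real.holderConjugate_iff_eq_conjExponent hq).mpr rfl
  have hgp : ∫⁻ x in Metric.ball c r, ENNReal.ofReal (w x) * ‖g x‖ₑ ^ p ≠ ⊤ := by
    have h1 := (lintegral_rpow_enorm_lt_top_of_eLpNorm_lt_top (by simpa using hp)
      ENNReal.ofReal_ne_top hg.2).ne
    rw [ENNReal.toReal_ofReal hp.le, weightMeasure,
      lintegral_withDensity_eq_lintegral_mul₀ hwm (hgm.enorm.pow_const _)] at h1
    exact ((setLIntegral_le_lintegral _ _).trans_lt h1.lt_top).ne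
  have hdual := hw.lintegral_dual_ne_top hq hw0 c r
  -- Splits `|g| ^ (p/q)` as `(w |g| ^ p) ^ (1/q) * w ^ (-1/q)`; the second factor raised to `q / (q
  -- - 1)` is the dual weight. The splitting fails where `w = 0`, so it is only an a.e. identity.
  have h2 := ENNReal.lintegral_mul_le_Lp_mul_Lq (volume.restrict (Metric.ball c r)) hconj
    (((hwm.mul (hgm.enorm.pow_const p)).pow_const (1 / q)).restrict)
    ((hwm.pow_const (-(1 / q))).restrict)
  refine ne_top_of_le_ne_top ?_ (le_trans (lintegral_mono_ae ?_) h2)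
  · refine ENNReal.mul_ne_top (ENNReal.rpow_ne_top_of_nonneg (by positivity) ?_)
      (ENNReal.rpow_ne_top_of_nonneg
        (div_nonneg zero_le_one (div_nonneg hq0.le (by linarith))) ?_)
    · refine ne_of_eq_of_ne (lintegral_congr fun x => ?_) hgp
      rw [← ENNReal.rpow_mul, one_div, inv_mul_cancel₀ hq0.ne', ENNReal.rpow_one]
      rfl
    · refine ne_of_eq_of_ne (lintegral_congr fun x => ?_) hdual
      rw [← ENNReal.rpow_mul]
      congr 1
      have : q - 1 ≠ 0 := by linarith
      have : 1 - q ≠ 0 := by linarith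
      field_simp
      ring
  · refine ae_restrict_of_ae ?_
    filter_upwards [hw.ae_ne_zero hq.le hw0] with x hx
    have hx0 : ENNReal.ofReal (w x) ≠ 0 := by
      simpa using lt_of_le_of_ne (hw.isWeight.nonneg x) hx.symm
    simp only [Pi.mul_apply]
    rw [ENNReal.mul_rpow_of_nonneg _ _ (by positivity), mul_right_comm,
      ← ENNReal.rpow_add _ _ hx0 ENNReal.ofReal_ne_top, add_neg_cancel, ENNReal.rpow_zero, one_mul,
      ← ENNReal.rpow_mul, mul_one_div]

end WeightedRBV

theorem mainTheorem4 (n : ℕ) (p : ℝ) (hp : 1 ≤ p) (w : EuclideanSpace ℝ (Fin n) → ℝ)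
    (hw : WeightedRBV.IsMuckenhoupt p w) (hw0 : ¬ (w =ᵐ[volume] 0)) :
    (∀ f : EuclideanSpace ℝ (Fin n) → ℝ, WeightedRBV.MemRBV p w f →
      ∀ᵐ x ∂volume, DifferentiableAt ℝ f x) ∧
    ((n : ℝ) * WeightedRBV.criticalIndex w < p →
      ∀ f : EuclideanSpace ℝ (Fin n) → ℝ, WeightedRBV.MemSobolev p w f →
        ∃ g : EuclideanSpace ℝ (Fin n) → ℝ, g =ᵐ[volume] f ∧ Continuous g ∧
          ∀ᵐ x ∂volume, DifferentiableAt ℝ g x) := by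
  refine ⟨fun f hf => hf.ae_differentiableAt hp hw hw0, fun hlt f hf => ?_⟩
  -- In dimension `0` there is no partial derivative to work with, but every function on a point is
  -- continuous and differentiable.
  rcases eq_or_ne n 0 with rfl | hn
  · exact ⟨f, ae_eq_refl f, continuous_of_const fun x y => by rw [Subsingleton.elim x y],
      ae_of_all _ fun x => (hasFDerivAt_of_subsingleton f x).differentiableAt⟩
  obtain ⟨q, hq1, hq, hqp⟩ :=
    WeightedRBV.exists_isMuckenhoupt_of_criticalIndex_lt hn hp hw hlt
  have hq0 : 0 < q := zero_lt_one.trans hq1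
  choose g hg hgp using hf.exists_deriv
  have hns : (n : ℝ) < p / q := (lt_div_iff₀ hq0).mpr hqp
  have hn1 : (1 : ℝ) ≤ n := by exact_mod_cast Nat.one_le_iff_ne_zero.mpr hn
  have hgm : ∀ j, AEMeasurable (g j) volume := fun j =>
    (hg j).locallyIntegrable_deriv.aestronglyMeasurable.aemeasurable
  refine exists_ae_eq_continuous_ae_differentiableAt
    (hg ⟨0, Nat.pos_of_ne_zero hn⟩).locallyIntegrable hg (hn1.trans_lt hns) hns fun c r => ?_
  rw [powerMeasure, withDensity_apply _ measurableSet_ball,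
    lintegral_finsetSum' _ fun j _ => ((hgm j).enorm.pow_const _).restrict]
  exact ENNReal.sum_ne_top.mpr fun j _ =>
    hq.lintegral_rpow_div_ne_top (zero_lt_one.trans_le hp) hq1 hw0 (hgm j) (hgp j) c r
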